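/- **Setting.** Let $k$ be a field. For $P\in k[x]$ of degree $N\ge 1$ put $A_P=k[x]/(P)$, with elements represented by their coordinates in the basis $1,x,\dots,x^{N-1}$. An element $\omega$ of a $k$-algebra $A$ is a *principal $m$-th root of unity* if $\omega^m=1$ and $1-\omega^\nu$ is not a zero divisor for $1\le\nu<m$; the DFT of order $m$ with respect to $\omega$ is $(a_\nu)_{0\le \nu<m}\mapsto\big(\sum_{\nu<m}\omega^{i\nu}a_\nu\big)_{0\le i<m}$. *Order sequences.* An order sequence of constant sparseness over $k$ is a sequence of positive integers $n_1<n_2<\cdots$ with $n_i\mid n_{i+1}\le s\,n_i$ for a constant $s$, such that for a constant $c$ every $n_i$ factors as $n_i=n_i'n_i''$, where some ring extension of $k$ of degree $n_i'$ contains a principal $n_i''$-th root of unity whose DFT is computable with at most $c\,n_i''\log n_i''$ operations over that extension. *Transforms.* A DFT procedure over $A_Q$ is a straight-line program, consisting of additions and subtractions in $A_Q$ and multiplications by powers of a principal $m$-th root of unity $\omega\in A_Q$ ($m\geq 1$), that computes the DFT of order $m$ with respect to $\omega$. An addition or subtraction in $A_Q$ costs $\deg Q$ operations in $k$; a multiplication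 by $\omega^e$ costs the linear complexity over $k$ of this map. A transform over $A_Q$ is a straight-line program of additions, subtractions and scalar multiplications in $k$ (cost $1$ each) and DFT procedures over $A_Q$. *Algorithms of type $\mathcal D$.* Fix an order sequence $\mathcal N$ of constant sparseness and a bound $B$. A DFT-based procedure for the multiplication in $A_P$, $\deg P=N$, is one of the following. * If $N\le B$: any arithmetic straight-line program over $k$ (constants free; additions, subtractions, scalar and nonscalar multiplications of cost $1$) that computes the product in $A_P$. * If $N=N'N''\in\mathcal N$: a recursive step given by a polynomial $Q$ of degree $N'$, a $k$-linear map $\psi:A_P\to (A_Q)^{2N''}$ and a $k$-linear map $\chi:(A_Q)^{2N''}\to A_P$ with $\chi(\psi(a)\psi(b))=ab$ for all $a,b\in A_P$ (componentwise product; in particular $\psi$ is injective), each of $\psi$ and $\chi$ computed by a transform over $A_Q$ that performs at least one DFT over $A_Q$ of order a multiple of $N''$, and a DFT-based procedure (with the same $\mathcal N$ and $B$) for the $2N''$ products in $A_Q$. Its cost is $$L'(P)=2N''\,L'(Q)+2\,T(\psi)+T(\chi),$$ where $T$ denotes the cost of the transforms. An *algorithm of type $\mathcal D$* over $k$ with base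 bound $B$ consists of an order sequence $\mathcal N$ of constant sparseness over $k$ and, for every $n\ge1$, a polynomial $P_n$ of degree $N\in\mathcal N$ with $2n-1\le N=O(n)$ and a DFT-based procedure for $A_{P_n}$; it multiplies two polynomials of degree at most $n-1$ in $A_{P_n}$. Its complexity $L_{\mathcal D}(n)$ is the cost of that procedure. **Statement.** Over the rationals, $L_{\mathcal D_{\mathbb Q}}(n)=\Omega(n\log n\log\log n)$. That is: for every $B$ there are $C>0$ and $n_0$ such that for every algorithm $\mathcal D$ of type $\mathcal D$ over $\mathbb Q$ with base bound $B$ and all $n\ge n_0$, $$L_{\mathcal D}(n)\ \ge\ C\,n\log n\,\log\log n .$$ -/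

import Mathlib

open Polynomial

noncomputable section

universe u

namespace DFTMul

/-! ### Straight-line programs

A program works on a memory, a list of values that initially holds the inputs. Each instruction
appends one value to the memory. Reading an address outside the memory returns `0`. -/

/-- A linear instruction: addition, subtraction, or multiplication by the scalar labelled `s`.
The natural numbers are memory addresses. -/
inductive LinOp (S : Type u) : Type u
  | add (i j : ℕ) : LinOp S
  | sub (i j : ℕ) : LinOp S
  | smul (s : S) (i : ℕ) : LinOp S

/-- The value of a linear instruction; `act s` is the multiplication by the scalar labelled `s`. -/
def LinOp.eval {S : Type u} {M : Type u} [AddGroup M] (act : S → M → M) (mem : List M) :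
    LinOp S → M
  | .add i j => mem.getD i 0 + mem.getD j 0
  | .sub i j => mem.getD i 0 - mem.getD j 0
  | .smul s i => act s (mem.getD i 0)

/-- The memory after a linear straight-line program. -/
def runLin {S : Type u} {M : Type u} [AddGroup M] (act : S → M → M) (code : List (LinOp S))
    (mem : List M) : List M :=
  code.foldl (fun mem o => mem ++ [o.eval act mem]) mem

/-- An instruction of a general (division-free) arithmetic straight-line program over a ring. -/
inductive ArithOp (R : Type u) : Type u
  | const (c : R) : ArithOp R
  | lin (o : LinOp R) : ArithOp R
  | mul (i j : ℕ) : ArithOp R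

/-- The value of an arithmetic instruction. -/
def ArithOp.eval {R : Type u} [Ring R] (mem : List R) : ArithOp R → R
  | .const c => c
  | .lin o => o.eval (fun s x => s * x) mem
  | .mul i j => mem.getD i 0 * mem.getD j 0

/-- Constants are free, every other operation costs `1`. -/
def ArithOp.cost {R : Type u} : ArithOp R → ℕ
  | .const _ => 0
  | .lin _ => 1
  | .mul _ _ => 1

/-- The memory after an arithmetic straight-line program. -/
def runArith {R : Type u} [Ring R] (code : List (ArithOp R)) (mem : List R) : List R :=
  code.foldl (fun mem o => mem ++ [o.eval mem]) mem

/-- The total number of arithmetic operations of a program. -/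
def arithCost {R : Type u} (code : List (ArithOp R)) : ℕ := (code.map ArithOp.cost).sum

/-- The linear complexity of a map `f : k^p → k^q`: the least number of additions, subtractions
and scalar multiplications of a linear straight-line program over `k` that computes `f`. -/
def linComplexity {k : Type u} [Field k] {p q : ℕ} (f : (Fin p → k) → (Fin q → k)) : ℕ :=
  sInf {t | ∃ (code : List (LinOp k)) (out : Fin q → ℕ), code.length = t ∧
    ∀ v j, (runLin (fun s x : k => s * x) code (List.ofFn v)).getD (out j) 0 = f v j}

/-! ### Roots of unity and Fourier transforms -/

/-- `ω` is a principal `n`-th root of unity: `ω ^ n = 1`, and `1 - ω ^ ν` is not a zero divisor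
for `1 ≤ ν < n`. -/
def IsPrincipalRoot {A : Type u} [Ring A] (n : ℕ) (ω : A) : Prop :=
  ω ^ n = 1 ∧ ∀ ν, 1 ≤ ν → ν < n → (1 - ω ^ ν) ∈ nonZeroDivisors A

/-- The discrete Fourier transform of order `n` with respect to `ω`. -/
def dft {A : Type u} [Ring A] {n : ℕ} (ω : A) (x : Fin n → A) : Fin n → A :=
  fun i => ∑ ν : Fin n, ω ^ ((i : ℕ) * (ν : ℕ)) * x ν

/-- The DFT of order `n` with respect to `ω` can be computed with at most `c n log n` operations
over `A`. -/
def IsSuitable {A : Type u} [Ring A] (c : ℝ) (n : ℕ) (ω : A) : Prop :=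
  ∃ (code : List (ArithOp A)) (out : Fin n → ℕ),
    (∀ x i, (runArith code (List.ofFn x)).getD (out i) 0 = dft ω x i) ∧
      (arithCost code : ℝ) ≤ c * (n * Real.logb 2 n)

/-- An order sequence of constant sparseness over the field `k`. -/
structure OrderSequence (k : Type u) [Field k] where
  term : ℕ → ℕ
  pos : ∀ i, 0 < term i
  lt_succ : ∀ i, term i < term (i + 1)
  dvd_succ : ∀ i, term i ∣ term (i + 1)
  sparseness : ℝ
  le_sparse : ∀ i, (term (i + 1) : ℝ) ≤ sparseness * term i
  suitConst : ℝ
  /-- Each term is `n' * n''`, where some ring extension of `k` of degree `n'` contains a principal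
  `n''`-th root of unity with a suitable DFT. -/
  extension : ∀ i, ∃ n' n'' : ℕ, term i = n' * n'' ∧
    ∃ (A : Type u) (_ : Ring A) (_ : Algebra k A) (ω : A),
      Module.finrank k A = n' ∧ IsPrincipalRoot n'' ω ∧ IsSuitable suitConst n'' ω

/-! ### The algebras `k[x]/(P)` -/

/-- A polynomial of positive degree. -/
structure Modulus (k : Type u) [Field k] where
  poly : k[X]
  pos : 0 < poly.natDegree

namespace Modulus

variable {k : Type u} [Field k]

/-- The degree `N` of the modulus `P_N`. -/
def deg (P : Modulus k) : ℕ := P.poly.natDegree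

/-- The algebra `A_N = k[x]/(P_N)`. -/
abbrev Alg (P : Modulus k) : Type u := AdjoinRoot P.poly

theorem ne_zero (P : Modulus k) : P.poly ≠ 0 := by
  intro h
  have := P.pos
  simp [h] at this

/-- Coordinates with respect to the basis `1, x, …, x ^ (N - 1)`. -/
def coords (P : Modulus k) : P.Alg ≃ₗ[k] (Fin P.deg → k) :=
  (AdjoinRoot.powerBasis P.ne_zero).basis.equivFun

/-- A tuple of elements of `A_N` as a list of `q * N` elements of `k`. -/
def encode (P : Modulus k) {q : ℕ} (x : Fin q → P.Alg) : List k :=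
  (List.ofFn fun i => List.ofFn (P.coords (x i))).flatten

end Modulus

/-! ### Transforms by means of DFTs -/

/-- A procedure for a DFT over `A_N`, built from additions and subtractions in `A_N` and
multiplications by powers of the principal root of unity; a scalar label `e` stands for
`root ^ e`. -/
structure DFTProcedure {k : Type u} [Field k] (P : Modulus k) where
  order : ℕ
  order_pos : 0 < order
  root : P.Alg
  principal : IsPrincipalRoot order root
  code : List (LinOp (ULift.{u} ℕ))
  out : Fin order → ℕ
  correct : ∀ x i,
    (runLin (fun e y => root ^ e.down * y) code (List.ofFn x)).getD (out i) 0 = dft root x i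

namespace DFTProcedure

variable {k : Type u} [Field k] {P : Modulus k}

/-- The number of operations in `k` for one instruction: an addition in `A_N` takes `N` additions
in `k`; a multiplication by `root ^ e` takes as many operations as the linear complexity of this
map in coordinates. -/
def opCost (D : DFTProcedure P) : LinOp (ULift.{u} ℕ) → ℕ
  | .add _ _ => P.deg
  | .sub _ _ => P.deg
  | .smul e _ => linComplexity fun v => P.coords (D.root ^ e.down * P.coords.symm v)

/-- The number of operations in `k` of a DFT procedure. -/
def cost (D : DFTProcedure P) : ℕ := (D.code.map D.opCost).sum

end DFTProcedure

/-- An instruction of a transform: a linear operation in `k`, or a DFT over the algebra of `P`,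
with the coordinates of its inputs read from the addresses `inp`. -/
inductive TransformOp {k : Type u} [Field k] (P : Modulus k) : Type u
  | lin (o : LinOp k) : TransformOp P
  | dft (D : DFTProcedure P) (inp : Fin D.order → Fin P.deg → ℕ) : TransformOp P

namespace TransformOp

variable {k : Type u} [Field k] {P : Modulus k}

/-- The values appended to the memory. -/
def eval (mem : List k) : TransformOp P → List k
  | .lin o => [o.eval (fun s x => s * x) mem]
  | .dft D inp => P.encode
      (DFTMul.dft D.root fun i => P.coords.symm fun j => mem.getD (inp i j) 0)

/-- The number of operations in `k`. -/
def cost : TransformOp P → ℕ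
  | .lin _ => 1
  | .dft D _ => D.cost

end TransformOp

/-- The memory after a transform. -/
def runTransform {k : Type u} [Field k] {P : Modulus k} (code : List (TransformOp P))
    (mem : List k) : List k :=
  code.foldl (fun mem o => mem ++ o.eval mem) mem

/-- The number of operations in `k` of a transform. -/
def transformCost {k : Type u} [Field k] {P : Modulus k} (code : List (TransformOp P)) : ℕ :=
  (code.map TransformOp.cost).sum

/-- The transform performs a DFT over the algebra of `P` whose order is a multiple of `n`. -/
def PerformsDFT {k : Type u} [Field k] {P : Modulus k} (code : List (TransformOp P)) (n : ℕ) :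
    Prop :=
  ∃ D inp, TransformOp.dft D inp ∈ code ∧ n ∣ D.order

/-! ### DFT-based multiplication -/

/-- A DFT-based recursive procedure for the multiplication in `A_N = k[x]/(P)`.

* `base`: if `N ≤ B`, any arithmetic straight-line program that computes the product.
* `step`: `N = N' * N''` is a term of the order sequence, and `Q` has degree `N'`. By means of DFTs
  over `A_{N'} = k[y]/(Q)` of order a multiple of `N''`, a linear map `ψ` from `A_N` to
  `(A_{N'})^(2 N'')` is computed; the images of both factors are multiplied componentwise by a
  procedure of the same kind; and a linear map `χ`, again computed by means of such DFTs, recovers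
  the product in `A_N`. (The last requirement makes `ψ` injective.) -/
inductive Procedure {k : Type u} [Field k] (𝒩 : OrderSequence k) (B : ℕ) : Modulus k → Type u
  | base (P : Modulus k) (small : P.deg ≤ B) (code : List (ArithOp k)) (out : Fin P.deg → ℕ)
      (correct : ∀ (a b : P.Alg) (i : Fin P.deg),
        (runArith code (List.ofFn (P.coords a) ++ List.ofFn (P.coords b))).getD (out i) 0 =
          P.coords (a * b) i) :
      Procedure 𝒩 B P
  | step (P Q : Modulus k) (N'' : ℕ)
      (mem_seq : P.deg ∈ Set.range 𝒩.term) (factor : P.deg = Q.deg * N'')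
      (ψ : P.Alg →ₗ[k] (Fin (2 * N'') → Q.Alg))
      (χ : (Fin (2 * N'') → Q.Alg) →ₗ[k] P.Alg)
      (mul_eq : ∀ a b : P.Alg, χ (ψ a * ψ b) = a * b)
      (fwd : List (TransformOp Q)) (fwdOut : Fin (2 * N'') → Fin Q.deg → ℕ)
      (fwd_dft : PerformsDFT fwd N'')
      (fwd_correct : ∀ (a : P.Alg) (j : Fin (2 * N'')) (i : Fin Q.deg),
        (runTransform fwd (List.ofFn (P.coords a))).getD (fwdOut j i) 0 = Q.coords (ψ a j) i)
      (bwd : List (TransformOp Q)) (bwdOut : Fin P.deg → ℕ)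
      (bwd_dft : PerformsDFT bwd N'')
      (bwd_correct : ∀ (c : Fin (2 * N'') → Q.Alg) (i : Fin P.deg),
        (runTransform bwd (Q.encode c)).getD (bwdOut i) 0 = P.coords (χ c) i)
      (inner : Procedure 𝒩 B Q) :
      Procedure 𝒩 B P

/-- The total number of operations in `k`. In a recursive step these are two forward transforms,
`2 N''` products in `A_{N'}` and one back-transform. -/
def Procedure.cost {k : Type u} [Field k] {𝒩 : OrderSequence k} {B : ℕ} {P : Modulus k} :
    Procedure 𝒩 B P → ℕ
  | .base _ _ code _ _ => arithCost code
  | .step _ _ N'' _ _ _ _ _ fwd _ _ _ bwd _ _ _ inner =>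
      2 * N'' * inner.cost + 2 * transformCost fwd + transformCost bwd

/-- A DFT-based polynomial multiplication algorithm of type `𝒟` over `k`, whose recursion ends in
algebras of dimension at most `B`: for each `n ≥ 1`, two polynomials of degree at most `n - 1` are
multiplied in `A_N = k[x]/(P_N)`, where `N` is a term of an order sequence of constant sparseness
and `2 n - 1 ≤ N = O(n)`. -/
structure Algorithm (k : Type u) [Field k] (B : ℕ) where
  seq : OrderSequence k
  modulus : ℕ → Modulus k
  mem_seq : ∀ n, 1 ≤ n → (modulus n).deg ∈ Set.range seq.term
  le_deg : ∀ n, 1 ≤ n → 2 * n - 1 ≤ (modulus n).deg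
  degConst : ℕ
  deg_le : ∀ n, 1 ≤ n → (modulus n).deg ≤ degConst * n
  procedure : ∀ n, Procedure seq B (modulus n)

/-- The total complexity `L_𝒟(n)` of the algorithm. -/
def Algorithm.complexity {k : Type u} [Field k] {B : ℕ} (𝒟 : Algorithm k B) (n : ℕ) : ℕ :=
  (𝒟.procedure n).cost

end DFTMul

end

open Polynomial

namespace DFTMul

/-! ### A lower bound for Euler's totient -/

/-! Two facts about one recursive step `N = N' N''` force the bound. A principal root of order
divisible by `N''` in `A_Q` maps, under some `A_Q → ℂ`, to a primitive root of unity, of degree at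
least `φ(N'')` over `ℚ`. Hence `φ(N'') ≤ N'` (`PerformsDFT.totient_le`), and since `φ(n)` is almost
`n`, `log N''` exceeds `log N'` at most by a doubly logarithmic term. So `log N` is at best about
halved per level. Moreover, Morgenstern's determinant argument shows that a DFT of order `m` built
from root powers needs at least `(m log m) / 2` additions, each costing `N'`
(`PerformsDFT.le_transformCost`). With `u = log N`, `v = log N''`, `w = log N'`, the cost per
dimension thus satisfies `f(v + w) ≥ 2 f(w) + v` with `v ≲ w`. Each of the roughly `log u` levels
contributes order `u`, so `f(u)` grows at least like `u log u`. `growth_add_le` makes this precise,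
and `Procedure.growth_le_cost` is the induction. -/

theorem inv_card_add_one_le_prod (s : Finset ℕ) (hs : ∀ p ∈ s, 2 ≤ p) :
    ((s.card : ℚ) + 1)⁻¹ ≤ ∏ p ∈ s, (1 - (p : ℚ)⁻¹) := by
  induction s using Finset.induction_on_max with
  | empty => simp
  | insert a s hlt ih =>
    have ha : a ∉ s := fun h => lt_irrefl _ (hlt a h)
    -- The maximum of `s.card + 1` distinct integers that are at least `2` is at least `s.card + 2`;
    -- the resulting bound telescopes as `∏ j / (j + 1)`.
    have hcard : s.card + 2 ≤ a := by
      have h2 : 2 ≤ a := hs a (Finset.mem_insert_self _ _)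
      have hsub : s ⊆ Finset.Ico 2 a := fun p hp =>
        Finset.mem_Ico.2 ⟨hs p (Finset.mem_insert_of_mem hp), hlt p hp⟩
      have := Finset.card_le_card hsub
      rw [Nat.card_Ico] at this
      omega
    have ih' := ih fun p hp => hs p (Finset.mem_insert_of_mem hp)
    rw [Finset.prod_insert ha, Finset.card_insert_of_notMem ha]
    have hc : (s.card : ℚ) + 2 ≤ a := by exact_mod_cast hcard
    have hpos : (0 : ℚ) < (s.card : ℚ) + 2 := by positivity
    have hinv : (a : ℚ)⁻¹ ≤ ((s.card : ℚ) + 2)⁻¹ := inv_anti₀ hpos hc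
    calc (((s.card + 1 : ℕ) : ℚ) + 1)⁻¹
        = (1 - ((s.card : ℚ) + 2)⁻¹) * ((s.card : ℚ) + 1)⁻¹ := by
          push_cast
          field_simp
          ring
      _ ≤ (1 - (a : ℚ)⁻¹) * ∏ p ∈ s, (1 - (p : ℚ)⁻¹) := by
          apply mul_le_mul (by linarith) ih' (by positivity)
          have : ((s.card : ℚ) + 2)⁻¹ ≤ 1 := inv_le_one_of_one_le₀
            (by linarith [(Nat.cast_nonneg s.card : (0:ℚ) ≤ s.card)])
          linarith

theorem le_totient_mul_card_primeFactors (n : ℕ) :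
    n ≤ n.totient * (n.primeFactors.card + 1) := by
  have h := inv_card_add_one_le_prod n.primeFactors fun p hp =>
    (Nat.prime_of_mem_primeFactors hp).two_le
  have h1 : (n : ℚ) * ((n.primeFactors.card : ℚ) + 1)⁻¹ ≤ n.totient := by
    rw [Nat.totient_eq_mul_prod_factors]
    gcongr
  rw [← div_eq_mul_inv, div_le_iff₀ (by positivity)] at h1
  exact_mod_cast h1

theorem two_pow_card_primeFactors_le {n : ℕ} (hn : n ≠ 0) : 2 ^ n.primeFactors.card ≤ n :=
  (Finset.pow_card_le_prod _ _ _ fun _ hp => (Nat.prime_of_mem_primeFactors hp).two_le).trans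
    (Nat.le_of_dvd (Nat.pos_of_ne_zero hn) (Nat.prod_primeFactors_dvd n))

/-- Since `n` has at most `log₂ n ≤ 2 log n` prime factors, `φ(n)` falls short of `n` by at most the
factor `1 + 2 log n`. -/
theorem log_le_log_totient_add {n : ℕ} (hn : 0 < n) :
    Real.log n ≤ Real.log n.totient + Real.log (1 + 2 * Real.log n) := by
  have hφ : (0 : ℝ) < n.totient := by exact_mod_cast Nat.totient_pos.2 hn
  have h1 : (n.primeFactors.card : ℝ) ≤ 2 * Real.log n := by
    have h : ((2 : ℝ) ^ n.primeFactors.card) ≤ n := by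
      exact_mod_cast two_pow_card_primeFactors_le hn.ne'
    have h' := Real.log_le_log (by positivity) h
    rw [Real.log_pow] at h'
    have := Real.log_two_gt_d9
    nlinarith [(Nat.cast_nonneg n.primeFactors.card : (0:ℝ) ≤ n.primeFactors.card)]
  have h2 : (n : ℝ) ≤ n.totient * (n.primeFactors.card + 1) := by
    exact_mod_cast le_totient_mul_card_primeFactors n
  have h0 : (0 : ℝ) ≤ Real.log n := Real.log_natCast_nonneg n
  rw [← Real.log_mul hφ.ne' (by positivity)]
  apply Real.log_le_log (by exact_mod_cast hn)
  exact h2.trans (mul_le_mul_of_nonneg_left (by linarith) hφ.le)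

/-! ### Morgenstern's volume bound -/

section Volume

/-- The number of additions and subtractions of a linear program. -/
def addCount {S : Type u} (code : List (LinOp S)) : ℕ :=
  (code.map fun o => match o with
    | .add _ _ => 1
    | .sub _ _ => 1
    | .smul _ _ => 0).sum

theorem getD_concat {M : Type*} (mem : List M) (x d : M) (i : ℕ) :
    (mem ++ [x]).getD i d = if i = mem.length then x else mem.getD i d := by
  rcases lt_trichotomy i mem.length with h | h | h
  · rw [List.getD_append _ _ _ _ h, if_neg h.ne]
  · subst h
    simp
  · rw [List.getD_eq_default _ _ (by simp; omega), List.getD_eq_default _ _ h.le, if_neg h.ne']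

/-- The minors of the values in the memory are bounded by `K`. -/
def MinorsLe {m : ℕ} (mem : List (Fin m → ℂ)) (K : ℝ) : Prop :=
  ∀ f : Fin m → ℕ, ‖(Matrix.of fun i => mem.getD (f i) 0).det‖ ≤ K

theorem MinorsLe.nonneg {m : ℕ} {mem : List (Fin m → ℂ)} {K : ℝ} (h : MinorsLe mem K) : 0 ≤ K :=
  (norm_nonneg _).trans (h fun _ => 0)

/-- It suffices to bound the minors in which the appended value occupies exactly one row. -/
theorem MinorsLe.concat {m : ℕ} {mem : List (Fin m → ℂ)} {K K' : ℝ} {x : Fin m → ℂ}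
    (h : MinorsLe mem K) (hK : K ≤ K')
    (hx : ∀ (f : Fin m → ℕ) (i : Fin m),
      ‖((Matrix.of fun i => mem.getD (f i) 0).updateRow i x).det‖ ≤ K') :
    MinorsLe (mem ++ [x]) K' := by
  intro f
  by_cases hex : ∃ i, f i = mem.length
  · obtain ⟨i, hi⟩ := hex
    by_cases huniq : ∃ j, j ≠ i ∧ f j = mem.length
    · obtain ⟨j, hji, hj⟩ := huniq
      rw [Matrix.det_zero_of_row_eq hji (by
        change (mem ++ [x]).getD (f j) 0 = (mem ++ [x]).getD (f i) 0
        rw [hi, hj]), norm_zero]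
      exact h.nonneg.trans hK
    · push Not at huniq
      -- Address `f i` is outside the old memory and reads `0` there, but row `i` is overwritten
      -- anyway.
      convert hx f i using 3
      ext j l
      by_cases hj : j = i
      · subst hj
        rw [Matrix.updateRow_self, Matrix.of_apply, getD_concat, if_pos hi]
      · rw [Matrix.updateRow_ne hj, Matrix.of_apply, Matrix.of_apply, getD_concat,
          if_neg (huniq j hj)]
  · push Not at hex
    have : (fun i => (mem ++ [x]).getD (f i) 0) = fun i => mem.getD (f i) 0 := by
      funext i
      rw [getD_concat, if_neg (hex i)]
    rw [this]
    exact (h f).trans hK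

theorem MinorsLe.updateRow {m : ℕ} {mem : List (Fin m → ℂ)} {K : ℝ} (h : MinorsLe mem K)
    (f : Fin m → ℕ) (i : Fin m) (a : ℕ) :
    ‖((Matrix.of fun i => mem.getD (f i) 0).updateRow i (mem.getD a 0)).det‖ ≤ K := by
  convert h (Function.update f i a) using 3
  ext j l
  by_cases hj : j = i
  · subst hj
    simp
  · simp [hj]

/-- The memory holds coefficient vectors of linear forms. A determinant is linear in the row of the
new value, so an addition or subtraction at most doubles the bound and a scalar of modulus one
preserves it. -/
theorem MinorsLe.runLin {S : Type} {m : ℕ} (c : S → ℂ) (hc : ∀ s, ‖c s‖ = 1)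
    (code : List (LinOp S)) :
    ∀ {mem : List (Fin m → ℂ)} {K : ℝ}, MinorsLe mem K →
      MinorsLe (runLin (fun s v => c s • v) code mem) (2 ^ addCount code * K) := by
  induction code with
  | nil =>
    intro mem K h
    simpa [addCount, DFTMul.runLin] using h
  | cons o code ih =>
    intro mem K h
    have hK := h.nonneg
    cases o with
    | add a b =>
      have h' : MinorsLe (mem ++ [mem.getD a 0 + mem.getD b 0]) (2 * K) := by
        refine h.concat (by linarith) fun f i => ?_
        rw [Matrix.det_updateRow_add]
        exact (norm_add_le _ _).trans (by linarith [h.updateRow f i a, h.updateRow f i b])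
      have hcount : addCount (LinOp.add a b :: code) = 1 + addCount code := by simp [addCount]
      rw [hcount, pow_add, pow_one, mul_comm 2, mul_assoc]
      exact ih h'
    | sub a b =>
      have h' : MinorsLe (mem ++ [mem.getD a 0 - mem.getD b 0]) (2 * K) := by
        refine h.concat (by linarith) fun f i => ?_
        rw [sub_eq_add_neg, ← neg_one_smul ℂ, Matrix.det_updateRow_add,
          Matrix.det_updateRow_smul]
        refine (norm_add_le _ _).trans ?_
        rw [norm_mul, norm_neg, norm_one, one_mul]
        linarith [h.updateRow f i a, h.updateRow f i b]
      have hcount : addCount (LinOp.sub a b :: code) = 1 + addCount code := by simp [addCount]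
      rw [hcount, pow_add, pow_one, mul_comm 2, mul_assoc]
      exact ih h'
    | smul s a =>
      have h' : MinorsLe (mem ++ [c s • mem.getD a 0]) K := by
        refine h.concat le_rfl fun f i => ?_
        rw [Matrix.det_updateRow_smul, norm_mul, hc, one_mul]
        exact h.updateRow f i a
      have hcount : addCount (LinOp.smul s a :: code) = addCount code := by simp [addCount]
      rw [hcount]
      exact ih h'

theorem getD_ofFn {M : Type*} {m : ℕ} (x : Fin m → M) (d : M) (i : ℕ) :
    (List.ofFn x).getD i d = if h : i < m then x ⟨i, h⟩ else d := by
  split_ifs with h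
  · rw [List.getD_eq_getElem _ _ (by simpa using h)]
    simp
  · exact List.getD_eq_default _ _ (by simpa using h)

/-- A minor of the inputs is `±1` for a permutation, and `0` if a row repeats or an address lies
outside the memory. -/
theorem minorsLe_single (m : ℕ) :
    MinorsLe (List.ofFn fun i : Fin m => (Pi.single i 1 : Fin m → ℂ)) 1 := by
  intro f
  by_cases hlt : ∀ i, f i < m
  · have hM : (Matrix.of fun i => (List.ofFn fun i : Fin m => (Pi.single i 1 : Fin m → ℂ)).getD
        (f i) 0) = (1 : Matrix (Fin m) (Fin m) ℂ).submatrix (fun i => ⟨f i, hlt i⟩) id := by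
      ext i j
      rw [Matrix.of_apply, getD_ofFn, dif_pos (hlt i)]
      simp [Matrix.one_apply, Pi.single_apply, eq_comm]
    rw [hM]
    by_cases hinj : Function.Injective fun i : Fin m => (⟨f i, hlt i⟩ : Fin m)
    · have hbij := Finite.injective_iff_bijective.1 hinj
      have := Matrix.det_permute (Equiv.ofBijective _ hbij) (1 : Matrix (Fin m) (Fin m) ℂ)
      rw [Equiv.coe_ofBijective] at this
      rw [this, Matrix.det_one, mul_one]
      rcases Int.units_eq_one_or (Equiv.Perm.sign (Equiv.ofBijective _ hbij)) with h | h <;>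
        simp [h]
    · simp only [Function.Injective] at hinj
      push Not at hinj
      obtain ⟨i, j, hij, hne⟩ := hinj
      rw [Matrix.det_zero_of_row_eq hne (by
        ext l
        exact congrArg (fun t : Fin m => (1 : Matrix (Fin m) (Fin m) ℂ) t (id l)) hij)]
      simp
  · push Not at hlt
    obtain ⟨i, hi⟩ := hlt
    rw [Matrix.det_eq_zero_of_row_eq_zero i]
    · simp
    · intro j
      rw [Matrix.of_apply, getD_ofFn, dif_neg (by omega)]
      rfl

end Volume

/-! ### Programs for the DFT -/

/-- This transports a program between `A`, `ℂ` and the vectors of coefficients in `ℂ^m`. -/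
theorem runLin_map {S : Type u} {M M' : Type u} [AddGroup M] [AddGroup M'] (h : M →+ M')
    {act : S → M → M} {act' : S → M' → M'} (hact : ∀ s x, h (act s x) = act' s (h x))
    (code : List (LinOp S)) :
    ∀ mem : List M, (runLin act code mem).map h = runLin act' code (mem.map h) := by
  induction code with
  | nil => intro mem; rfl
  | cons o code ih =>
    intro mem
    have hD : ∀ i, h (mem.getD i 0) = (mem.map h).getD i 0 := fun i =>
      (List.getD_map mem 0 h).symm.trans (by rw [map_zero])
    have ho : h (o.eval act mem) = o.eval act' (mem.map h) := by
      cases o <;> simp only [LinOp.eval, map_add, map_sub, hact, hD]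
    have := ih (mem ++ [o.eval act mem])
    rw [List.map_append, List.map_singleton, ho] at this
    exact this

/-- The matrix of the DFT of order `m`. -/
def dftMatrix (m : ℕ) (ζ : ℂ) : Matrix (Fin m) (Fin m) ℂ :=
  Matrix.of fun i j => ζ ^ ((i : ℕ) * (j : ℕ))

theorem dftMatrix_mul_conjTranspose {m : ℕ} {ζ : ℂ} (hζ : IsPrimitiveRoot ζ m) :
    dftMatrix m ζ * (dftMatrix m ζ).conjTranspose = (m : ℂ) • 1 := by
  rcases Nat.eq_zero_or_pos m with rfl | hm
  · ext i; exact i.elim0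
  have hnorm : ‖ζ‖ = 1 := hζ.norm'_eq_one hm.ne'
  have h0 : ζ ≠ 0 := hζ.ne_zero hm.ne'
  have hconj : star ζ = ζ⁻¹ := by
    rw [Complex.inv_def, Complex.normSq_eq_norm_sq, hnorm]
    simp
  ext i j
  rw [Matrix.mul_apply]
  simp only [dftMatrix, Matrix.of_apply, Matrix.conjTranspose_apply, star_pow, hconj,
    Matrix.smul_apply, smul_eq_mul]
  have hterm : ∀ k : Fin m, ζ ^ ((i : ℕ) * k) * ζ⁻¹ ^ ((j : ℕ) * k) =
      (ζ ^ (i : ℕ) * (ζ ^ (j : ℕ))⁻¹) ^ (k : ℕ) := by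
    intro k
    rw [mul_pow, ← pow_mul, inv_pow, inv_pow, ← pow_mul]
  -- Each entry is a geometric sum; off the diagonal its ratio is an `m`-th root of unity other than
  -- `1`.
  rw [Finset.sum_congr rfl fun k _ => hterm k]
  by_cases hij : i = j
  · subst hij
    rw [mul_inv_cancel₀ (pow_ne_zero _ h0)]
    simp
  · rw [Matrix.one_apply_ne hij, mul_zero,
      Fin.sum_univ_eq_sum_range (fun k => (ζ ^ (i : ℕ) * (ζ ^ (j : ℕ))⁻¹) ^ k) m,
      geom_sum_eq]
    · rw [mul_pow, inv_pow, ← pow_mul, ← pow_mul, mul_comm, mul_comm _ m, pow_mul, mul_comm _ m,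
        pow_mul, hζ.pow_eq_one]
      simp
    · intro h
      rw [mul_inv_eq_one₀ (pow_ne_zero _ h0)] at h
      exact hij (Fin.ext (hζ.pow_inj i.2 j.2 h))

theorem norm_det_dftMatrix_sq {m : ℕ} {ζ : ℂ} (hζ : IsPrimitiveRoot ζ m) :
    ‖(dftMatrix m ζ).det‖ ^ 2 = (m : ℝ) ^ m := by
  have h := congrArg (fun M => ‖Matrix.det M‖) (dftMatrix_mul_conjTranspose hζ)
  simpa [Matrix.det_mul, Matrix.det_conjTranspose, ← sq, Matrix.det_smul] using h

/-- Morgenstern's bound: a program for the DFT of order `m` whose only scalars are powers of the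
root of unity uses at least `(m / 2) log₂ m` additions and subtractions. -/
theorem pow_self_le_of_dft_program {A : Type} [CommRing A] (σ : A →+* ℂ) {m : ℕ} (hm : 0 < m)
    {ω : A} (hσ : IsPrimitiveRoot (σ ω) m) (code : List (LinOp (ULift.{0} ℕ))) (out : Fin m → ℕ)
    (correct : ∀ x i,
      (runLin (fun e y => ω ^ e.down * y) code (List.ofFn x)).getD (out i) 0 = dft ω x i) :
    m ^ m ≤ 4 ^ addCount code := by
  have hnorm : ‖σ ω‖ = 1 := hσ.norm'_eq_one hm.ne'
  have hminor := (minorsLe_single m).runLin (fun e : ULift.{0} ℕ => σ ω ^ e.down)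
    (fun e => by rw [norm_pow, hnorm, one_pow]) code
  have hmat : (Matrix.of fun i => (runLin (fun (e : ULift.{0} ℕ) (v : Fin m → ℂ) =>
      σ ω ^ e.down • v) code (List.ofFn fun i : Fin m => (Pi.single i 1 : Fin m → ℂ))).getD
        (out i) 0) = dftMatrix m (σ ω) := by
    ext i j
    set R := runLin (fun (e : ULift.{0} ℕ) (v : Fin m → ℂ) => σ ω ^ e.down • v) code
      (List.ofFn fun i : Fin m => (Pi.single i 1 : Fin m → ℂ)) with hR
    have h1 := runLin_map (Pi.evalAddMonoidHom (fun _ : Fin m => ℂ) j)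
      (act := fun (e : ULift.{0} ℕ) (v : Fin m → ℂ) => σ ω ^ e.down • v)
      (act' := fun e y => σ ω ^ e.down * y) (fun s x => rfl) code
      (List.ofFn fun i : Fin m => (Pi.single i 1 : Fin m → ℂ))
    have h2 := runLin_map (σ : A →+ ℂ) (act := fun (e : ULift.{0} ℕ) y => ω ^ e.down * y)
      (act' := fun e y => σ ω ^ e.down * y) (fun s x => by simp) code
      (List.ofFn (Pi.single j 1 : Fin m → A))
    -- Coordinate `j` of the run on coefficient vectors and the `σ`-image of the run over `A` on the
    -- `j`-th unit vector are the same run in `ℂ`; it yields column `j` of the DFT matrix.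
    have hstart : (List.ofFn fun i : Fin m => (Pi.single i 1 : Fin m → ℂ)).map
        (Pi.evalAddMonoidHom (fun _ : Fin m => ℂ) j) =
        (List.ofFn (Pi.single j 1 : Fin m → A)).map (σ : A →+ ℂ) := by
      rw [List.map_ofFn, List.map_ofFn]
      congr 1
      funext i
      by_cases h : i = j
      · subst h; simp
      · simp [h, Ne.symm h]
    rw [hstart, ← h2, ← hR] at h1
    have h3 := congrArg (fun l => l.getD (out i) 0) h1
    rw [← map_zero (Pi.evalAddMonoidHom (fun _ : Fin m => ℂ) j), List.getD_map, map_zero] at h3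
    rw [← map_zero (σ : A →+ ℂ), List.getD_map, correct] at h3
    change R.getD (out i) 0 j = _
    refine Eq.trans h3 ?_
    simp [dft, dftMatrix, Pi.single_apply]
  have h := hminor out
  rw [hmat, mul_one] at h
  have hsq : ‖(dftMatrix m (σ ω)).det‖ ^ 2 ≤ (2 ^ addCount code) ^ 2 :=
    pow_le_pow_left₀ (norm_nonneg _) h 2
  rw [norm_det_dftMatrix_sq hσ, ← pow_mul, mul_comm, pow_mul] at hsq
  norm_num at hsq
  exact_mod_cast hsq

/-! ### Order and cost of DFTs over `ℚ[x]/(Q)`, by passing to `ℂ` -/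

theorem IsPrincipalRoot.isPrimitiveRoot_map {A : Type*} [CommRing A] [IsArtinianRing A]
    {K : Type*} [Field K] (σ : A →+* K) {m : ℕ} (hm : 0 < m) {ω : A}
    (h : IsPrincipalRoot m ω) : IsPrimitiveRoot (σ ω) m := by
  refine IsPrimitiveRoot.mk_of_lt _ hm (by rw [← map_pow, h.1, map_one]) fun l hl hlm heq => ?_
  -- In an Artinian ring non-zero-divisors are units, so `σ` cannot send `1 - ω ^ l` to `0`.
  have hu := (IsArtinianRing.isUnit_of_mem_nonZeroDivisors (h.2 l hl hlm)).map σ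
  rw [map_sub, map_one, map_pow, heq, sub_self] at hu
  exact not_isUnit_zero hu

namespace Modulus

instance (P : Modulus ℚ) : Module.Finite ℚ P.Alg :=
  (AdjoinRoot.powerBasis P.ne_zero).finite

theorem finrank_alg (P : Modulus ℚ) : Module.finrank ℚ P.Alg = P.deg := by
  rw [(AdjoinRoot.powerBasis P.ne_zero).finrank, AdjoinRoot.powerBasis_dim]
  rfl

theorem exists_algHom_complex (P : Modulus ℚ) : Nonempty (P.Alg →ₐ[ℚ] ℂ) := by
  obtain ⟨z, hz⟩ := IsAlgClosed.exists_aeval_eq_zero ℂ P.poly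
    (fun h => P.pos.ne' (natDegree_eq_of_degree_eq_some h))
  exact ⟨AdjoinRoot.liftAlgHom P.poly (Algebra.ofId ℚ ℂ) z hz⟩

instance (P : Modulus ℚ) : IsArtinianRing P.Alg := IsArtinianRing.of_finite ℚ P.Alg

end Modulus

namespace DFTProcedure

variable {Q : Modulus ℚ}

/-- The cyclotomic polynomial is irreducible over `ℚ`, hence divides the minimal polynomial of the
root, whose degree is at most the dimension of `A_Q`. -/
theorem totient_order_le_deg (D : DFTProcedure Q) : D.order.totient ≤ Q.deg := by
  obtain ⟨σ⟩ := Q.exists_algHom_complex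
  have hσ : IsPrimitiveRoot (σ D.root) D.order :=
    D.principal.isPrimitiveRoot_map σ.toRingHom D.order_pos
  have hdvd : minpoly ℚ (σ D.root) ∣ minpoly ℚ D.root :=
    minpoly.dvd ℚ _ (by rw [aeval_algHom_apply, minpoly.aeval, map_zero])
  rw [← natDegree_cyclotomic D.order ℚ, cyclotomic_eq_minpoly_rat hσ D.order_pos,
    ← Q.finrank_alg]
  exact (natDegree_le_of_dvd hdvd (minpoly.ne_zero (Algebra.IsIntegral.isIntegral _))).trans
    (minpoly.natDegree_le _)

theorem deg_mul_addCount_le_cost (D : DFTProcedure Q) : Q.deg * addCount D.code ≤ D.cost := by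
  rw [cost, addCount, ← List.sum_map_mul_left]
  refine List.sum_le_sum fun o _ => ?_
  cases o <;> simp [opCost]

theorem order_mul_log_le_addCount (D : DFTProcedure Q) :
    D.order * Real.log D.order ≤ 2 * addCount D.code := by
  obtain ⟨σ⟩ := Q.exists_algHom_complex
  have h := pow_self_le_of_dft_program σ.toRingHom D.order_pos
    (D.principal.isPrimitiveRoot_map σ.toRingHom D.order_pos) D.code D.out D.correct
  have h' : (D.order : ℝ) ^ D.order ≤ 4 ^ addCount D.code := by exact_mod_cast h
  have hpos : (0 : ℝ) < D.order := by exact_mod_cast D.order_pos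
  have hlog := Real.log_le_log (by positivity) h'
  rw [Real.log_pow, Real.log_pow] at hlog
  have h4 : Real.log 4 ≤ 2 := by
    rw [show (4 : ℝ) = 2 ^ 2 by norm_num, Real.log_pow]
    have := Real.log_two_lt_d9
    push_cast
    linarith
  calc _ ≤ _ := hlog
    _ ≤ addCount D.code * 2 := by gcongr
    _ = _ := mul_comm _ _

end DFTProcedure

theorem PerformsDFT.totient_le {Q : Modulus ℚ} {code : List (TransformOp Q)} {n : ℕ}
    (h : PerformsDFT code n) : n.totient ≤ Q.deg := by
  obtain ⟨D, -, -, hdvd⟩ := h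
  exact (Nat.le_of_dvd (Nat.totient_pos.2 D.order_pos) (Nat.totient_dvd_of_dvd hdvd)).trans
    D.totient_order_le_deg

theorem PerformsDFT.le_transformCost {Q : Modulus ℚ} {code : List (TransformOp Q)} {n : ℕ}
    (hn : 0 < n) (h : PerformsDFT code n) :
    (Q.deg : ℝ) * n * Real.log n ≤ 2 * transformCost code := by
  obtain ⟨D, inp, hmem, hdvd⟩ := h
  have hcost : Q.deg * addCount D.code ≤ transformCost code :=
    D.deg_mul_addCount_le_cost.trans
      (List.single_le_sum (fun _ _ => Nat.zero_le _) _
        (List.mem_map_of_mem (f := TransformOp.cost) hmem))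
  have hcost' : (Q.deg : ℝ) * addCount D.code ≤ transformCost code := by exact_mod_cast hcost
  have hle : (n : ℝ) ≤ D.order := by exact_mod_cast Nat.le_of_dvd D.order_pos hdvd
  have hn' : (0 : ℝ) < n := by exact_mod_cast hn
  have hlog : Real.log n ≤ Real.log D.order := Real.log_le_log hn' hle
  calc (Q.deg : ℝ) * n * Real.log n = Q.deg * (n * Real.log n) := mul_assoc _ _ _
    _ ≤ Q.deg * (D.order * Real.log D.order) := by
        have := Real.log_natCast_nonneg n
        gcongr
    _ ≤ Q.deg * (2 * addCount D.code) := by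
        have := D.order_mul_log_le_addCount
        gcongr
    _ = 2 * (Q.deg * addCount D.code) := by ring
    _ ≤ _ := by linarith

/-! ### The recurrence -/

/-- The comparison function `u ↦ u log⁺ (u / U)`. -/
noncomputable def growth (U u : ℝ) : ℝ := u * max 0 (Real.log (u / U))

theorem growth_mono {U : ℝ} (hU : 0 < U) {u v : ℝ} (hu : 0 < u) (huv : u ≤ v) :
    growth U u ≤ growth U v := by
  have : Real.log (u / U) ≤ Real.log (v / U) := Real.log_le_log (by positivity) (by gcongr)
  unfold growth
  have h0 := le_max_left 0 (Real.log (v / U))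
  have hv : 0 ≤ v := hu.le.trans huv
  gcongr

theorem growth_of_le {U u : ℝ} (hU : 0 < U) (hu : 0 ≤ u) (h : u ≤ U) : growth U u = 0 := by
  rw [growth, max_eq_left, mul_zero]
  exact Real.log_nonpos (by positivity) ((div_le_one hU).2 h)

/-- In the balanced case `v = w` the factor `2` matches the doubling of `u`, and the change of the
logarithm is paid for by a multiple of `v`. The slack in `20 v` absorbs the small excess of `v` over
`w`. -/
theorem growth_add_le {U v w : ℝ} (hU : 2 ≤ U) (hv : 0 ≤ v) (hw : 0 ≤ w)
    (hvw : v ≤ w + Real.log (1 + 2 * v)) :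
    growth U (v + w) ≤ 2 * growth U w + 20 * v := by
  have hU0 : 0 < U := by linarith
  -- The tangent to the logarithm at `4` bounds `log (1 + 2 v)` by `v / 2` plus a constant.
  have hlin : v ≤ 2 * w + 2 := by
    have h4 : Real.log 4 ≤ 2 * 0.6931471808 := by
      rw [show (4 : ℝ) = 2 ^ 2 by norm_num, Real.log_pow]
      have := Real.log_two_lt_d9
      push_cast
      linarith
    have h1 : Real.log (1 + 2 * v) = Real.log ((1 + 2 * v) / 4) + Real.log 4 := by
      rw [← Real.log_mul (by positivity) (by norm_num)]
      congr 1
      ring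
    have h2 := Real.log_le_sub_one_of_pos (show 0 < (1 + 2 * v) / 4 by positivity)
    linarith
  rcases le_or_gt (v + w) U with hsmall | hbig
  · rw [growth_of_le hU0 (by positivity) hsmall]
    unfold growth
    positivity
  have hlogpos : 0 ≤ Real.log ((v + w) / U) := Real.log_nonneg ((one_le_div hU0).2 hbig.le)
  have hL : growth U (v + w) = (v + w) * Real.log ((v + w) / U) := by
    rw [growth, max_eq_right hlogpos]
  rcases lt_or_ge w U with hwU | hwU
  · rw [growth_of_le hU0 hw hwU.le, hL]
    have h1 := Real.log_le_sub_one_of_pos (div_pos (hU0.trans hbig) hU0)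
    have h2 : Real.log ((v + w) / U) ≤ v / U := by
      have : (v + w) / U ≤ v / U + 1 := by
        rw [div_add_one hU0.ne']
        gcongr
      linarith
    -- Here `v + w ≤ 3 w + 2 ≤ 4 U`, well within `20 U`.
    calc (v + w) * Real.log ((v + w) / U) ≤ (20 * U) * (v / U) := by
          gcongr
          linarith
      _ = 20 * v := by field_simp
      _ ≤ _ := by linarith
  · have hw0 : 0 < w := by linarith
    have hlw : 0 ≤ Real.log (w / U) := Real.log_nonneg ((one_le_div hU0).2 hwU)
    have hR : growth U w = w * Real.log (w / U) := by rw [growth, max_eq_right hlw]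
    have hsplit : Real.log ((v + w) / U) ≤ Real.log (w / U) + v / w := by
      rw [show (v + w) / U = (w / U) * (1 + v / w) by field_simp; ring,
        Real.log_mul (by positivity) (by positivity)]
      have := Real.log_le_sub_one_of_pos (show 0 < 1 + v / w by positivity)
      linarith
    -- Only `w < v` matters; then both factors are `O(√v)`.
    have hfirst : (v - w) * Real.log (w / U) ≤ 12 * v := by
      rcases le_or_gt v w with h | h
      · have : (v - w) * Real.log (w / U) ≤ 0 :=
          mul_nonpos_of_nonpos_of_nonneg (by linarith) hlw
        linarith
      · have hs : 0 ≤ √v := Real.sqrt_nonneg _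
        have hss : √v * √v = v := Real.mul_self_sqrt hv
        have hs1 : 1 ≤ √v := Real.one_le_sqrt.2 (by linarith)
        have hlv : Real.log (w / U) ≤ 2 * √v := by
          have h1 : Real.log (w / U) ≤ Real.log v := by
            apply Real.log_le_log (by positivity)
            rw [div_le_iff₀ hU0]
            nlinarith
          have h2 : Real.log v = 2 * Real.log √v := by
            rw [Real.log_sqrt hv]; ring
          have := Real.log_le_sub_one_of_pos (show 0 < √v by linarith)
          linarith
        have hle : Real.log (1 + 2 * v) ≤ 4 * √v := by
          have h1 : Real.log (1 + 2 * v) ≤ Real.log ((2 * √v) ^ 2) := by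
            apply Real.log_le_log (by positivity)
            nlinarith
          rw [Real.log_pow] at h1
          have := Real.log_le_sub_one_of_pos (show 0 < 2 * √v by linarith)
          push_cast at h1
          linarith
        calc (v - w) * Real.log (w / U) ≤ (4 * √v) * (2 * √v) := by
              gcongr
              linarith
          _ = 8 * v := by rw [← hss]; ring_nf; rw [Real.sqrt_sq hs]
          _ ≤ 12 * v := by linarith
    -- As `w ≥ U ≥ 2`, `hlin` gives `v ≤ 3 w`.
    have hsecond : (v + w) * (v / w) ≤ 8 * v := by
      rw [← mul_div_assoc, div_le_iff₀ hw0]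
      nlinarith
    rw [hL, hR]
    calc (v + w) * Real.log ((v + w) / U) ≤ (v + w) * (Real.log (w / U) + v / w) := by gcongr
      _ = 2 * (w * Real.log (w / U)) + (v - w) * Real.log (w / U) + (v + w) * (v / w) := by ring
      _ ≤ _ := by linarith

/-- Base programs need no lower bound, because `growth` vanishes up to `U ≥ log B`. In a step the
two forward transforms alone pay for the term `20 v`. -/
theorem Procedure.growth_le_cost {𝒩 : OrderSequence ℚ} {B : ℕ} {U : ℝ} (hU : 2 ≤ U)
    (hB : Real.log B ≤ U) {P : Modulus ℚ} (p : Procedure 𝒩 B P) :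
    (P.deg : ℝ) * growth U (Real.log P.deg) ≤ 20 * p.cost := by
  induction p with
  | base P small code out correct =>
    have hP : (0 : ℝ) < P.deg := by exact_mod_cast P.pos
    rw [growth_of_le (by linarith) (Real.log_natCast_nonneg _)
      ((Real.log_le_log hP (by exact_mod_cast small)).trans hB), mul_zero]
    positivity
  | step P Q n mem_seq factor ψ χ mul_eq fwd fwdOut fwd_dft fwd_correct bwd bwdOut bwd_dft
      bwd_correct inner ih =>
    have hP : 0 < P.deg := P.pos
    have hQ : (0 : ℝ) < Q.deg := by exact_mod_cast Q.pos
    have hn : 0 < n := Nat.pos_of_ne_zero fun h => by simp [factor, h] at hP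
    have hn' : (0 : ℝ) < n := by exact_mod_cast hn
    have hlogP : Real.log P.deg = Real.log n + Real.log Q.deg := by
      rw [factor, Nat.cast_mul, Real.log_mul hQ.ne' hn'.ne', add_comm]
    have hφ : Real.log n ≤ Real.log Q.deg + Real.log (1 + 2 * Real.log n) := by
      refine (log_le_log_totient_add hn).trans (add_le_add (Real.log_le_log ?_ ?_) le_rfl)
      · exact_mod_cast Nat.totient_pos.2 hn
      · exact_mod_cast fwd_dft.totient_le
    have hg := growth_add_le hU (Real.log_natCast_nonneg n) (Real.log_natCast_nonneg Q.deg) hφ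
    have hf := fwd_dft.le_transformCost hn
    have hb : (0 : ℝ) ≤ transformCost bwd := Nat.cast_nonneg _
    rw [hlogP, factor, Procedure.cost]
    push_cast
    calc (Q.deg : ℝ) * n * growth U (Real.log n + Real.log Q.deg)
        ≤ Q.deg * n * (2 * growth U (Real.log Q.deg) + 20 * Real.log n) := by gcongr
      _ = 2 * n * (Q.deg * growth U (Real.log Q.deg)) + 20 * (Q.deg * n * Real.log n) := by ring
      _ ≤ 2 * n * (20 * inner.cost) + 20 * (2 * transformCost fwd) := by gcongr
      _ ≤ _ := by linarith

end DFTMul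

theorem mainTheorem3 (B : ℕ) :
    ∃ C : ℝ, 0 < C ∧ ∃ n₀ : ℕ, ∀ 𝒟 : DFTMul.Algorithm ℚ B, ∀ n : ℕ, n₀ ≤ n →
      C * ((n : ℝ) * Real.log n * Real.log (Real.log n)) ≤ (𝒟.complexity n : ℝ) := by
  set U : ℝ := max 2 (Real.log B) with hUdef
  have hU : 2 ≤ U := le_max_left _ _
  have hU0 : 0 < U := by linarith
  -- For `log n ≥ U ^ 2` one has `log (log n / U) ≥ (log log n) / 2`; this `1 / 2` and the factor
  -- `20` give `1 / 40`. Both constants depend on `B` at most.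
  refine ⟨1 / 40, by norm_num, ⌈Real.exp (U ^ 2)⌉₊, fun 𝒟 n hn => ?_⟩
  have hexp : Real.exp (U ^ 2) ≤ n := Nat.ceil_le.1 hn
  have hn0 : (0 : ℝ) < n := (Real.exp_pos _).trans_le hexp
  have hn1 : 1 ≤ n := by exact_mod_cast hn0
  have hlog : U ^ 2 ≤ Real.log n := (Real.le_log_iff_exp_le hn0).2 hexp
  have hlog0 : 0 < Real.log n := lt_of_lt_of_le (by positivity) hlog
  have hll : 2 * Real.log U ≤ Real.log (Real.log n) := by
    have := Real.log_le_log (by positivity) hlog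
    rwa [Real.log_pow] at this
  have hdeg : (n : ℝ) ≤ (𝒟.modulus n).deg := by
    have := 𝒟.le_deg n hn1
    exact_mod_cast (by omega : n ≤ (𝒟.modulus n).deg)
  have hcost := (𝒟.procedure n).growth_le_cost hU (le_max_right _ _)
  have hmono : DFTMul.growth U (Real.log n) ≤
      DFTMul.growth U (Real.log (𝒟.modulus n).deg) :=
    DFTMul.growth_mono hU0 hlog0 (Real.log_le_log hn0 hdeg)
  have hgrowth : Real.log n * (Real.log (Real.log n) / 2) ≤ DFTMul.growth U (Real.log n) := by
    unfold DFTMul.growth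
    gcongr
    refine le_trans ?_ (le_max_right _ _)
    rw [Real.log_div hlog0.ne' hU0.ne']
    linarith
  have hloglog : 0 ≤ Real.log (Real.log n) := by
    have := Real.log_nonneg (show (1 : ℝ) ≤ U by linarith)
    linarith
  have hmain : (n : ℝ) * (Real.log n * (Real.log (Real.log n) / 2)) ≤
      20 * (𝒟.procedure n).cost := by
    refine le_trans ?_ hcost
    gcongr
    exact hgrowth.trans hmono
  unfold DFTMul.Algorithm.complexity
  linarith
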